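/- **Theorem.** Let $\mathbb{P}$ denote the set of primes. For an integer $n \ge 0$ let $p_{\mathbb{P}}(n)$ be the number of partitions of $n$ into parts that are all prime. Let $M(n)$ be the number of distinct values of the multinomial coefficients $$\binom{n}{i_1,\dots,i_n} = \frac{n!}{i_1!\cdots i_n!},\qquad i_1,\dots,i_n\ge 0,\quad i_1+\cdots+i_n=n,$$ and let $M_{\{1\}\cup\mathbb{P}}(n)$ be the number of distinct values of the multinomial coefficients $\frac{n!}{i_1!\cdots i_k!}$, where $k \ge 0$ is arbitrary, $i_1+\cdots+i_k=n$, and every lower entry $i_j$ is either $1$ or a prime. Then $$\lim_{n\to\infty}\frac{p_{\mathbb{P}}(n)}{M_{\{1\}\cup\mathbb{P}}(n)} = 0$$ and therefore $$\lim_{n\to\infty}\frac{p_{\mathbb{P}}(n)}{M(n)} = 0.$$ -/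

import Mathlib

namespace MultinomialCount

/-- The set of primes. -/
def primes : Set ℕ := {p | p.Prime}

/-- The set of values of the multinomial coefficients `n! / (i₁! ⋯ iₖ!)` with exactly `k` lower
entries `i₁, …, iₖ ≥ 0` satisfying `i₁ + ⋯ + iₖ = n`. -/
def values (k n : ℕ) : Set ℕ :=
  {m | ∃ i : Fin k → ℕ, ∑ j, i j = n ∧ Nat.multinomial Finset.univ i = m}

/-- `M_k(n)`: the number of different values of the multinomial coefficients with upper entry `n`
and `k` lower entries. -/
noncomputable def Mk (k n : ℕ) : ℕ := (values k n).ncard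

/-- `M(n) = M_n(n)`: the total number of distinct multinomial coefficients with upper entry `n`. -/
noncomputable def M (n : ℕ) : ℕ := Mk n n

/-- The set of values of the multinomial coefficients with upper entry `n` (and any number of
lower entries) all of whose lower entries belong to `S`. -/
def valuesIn (S : Set ℕ) (n : ℕ) : Set ℕ :=
  {m | ∃ (k : ℕ) (i : Fin k → ℕ),
    (∀ j, i j ∈ S) ∧ ∑ j, i j = n ∧ Nat.multinomial Finset.univ i = m}

/-- `M_S(n)`: the number of different multinomial coefficients with upper entry `n` whose lower
entries belong to `S`. -/
noncomputable def MIn (S : Set ℕ) (n : ℕ) : ℕ := (valuesIn S n).ncard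

/-- `p_S(n)`: the number of partitions of `n` into parts belonging to `S`. -/
noncomputable def pIn (S : Set ℕ) (n : ℕ) : ℕ :=
  {l : n.Partition | ∀ a ∈ l.parts, a ∈ S}.ncard

/-! The sets of values are finite, so that the cardinalities above are genuine, and the
denominators of the quotients considered below never vanish. -/

theorem valuesIn_finite (S : Set ℕ) (n : ℕ) : (valuesIn S n).Finite := by
  refine (Set.finite_Iic n.factorial).subset ?_
  rintro m ⟨k, i, -, hi, rfl⟩
  refine Nat.le_of_dvd (Nat.factorial_pos n) ⟨∏ j, (i j).factorial, ?_⟩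
  rw [← hi, ← Nat.multinomial_spec, mul_comm]

theorem values_finite (k n : ℕ) : (values k n).Finite :=
  (valuesIn_finite Set.univ n).subset fun _ ⟨i, hi, hm⟩ => ⟨k, i, fun _ => trivial, hi, hm⟩

theorem M_pos (n : ℕ) : 0 < M n :=
  (Set.ncard_pos (values_finite n n)).2 ⟨_, fun _ => 1, by simp, rfl⟩

theorem MIn_pos (n : ℕ) : 0 < MIn ({1} ∪ primes) n :=
  (Set.ncard_pos (valuesIn_finite _ n)).2 ⟨_, n, fun _ => 1, fun _ => Or.inl rfl, by simp, rfl⟩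

end MultinomialCount

namespace MultinomialCount

open Finset

/-! Let A(n) count the multisets of primes with sum at most n. Padding such a multiset with ones
gives a multinomial coefficient, and its value determines the multiset (`eq_of_prod_factorial_eq`),
so A(n) bounds both denominators from below. It remains to see that the prime partitions of n are
negligible against A(n). Those with at most K distinct parts number at most (n+1)^(2K), while A(n)
outgrows every polynomial. Each of the others yields more than K multisets by deleting one part. The
deleted part is n minus the remaining sum, so no multiset arises twice, and these partitions number
at most A(n)/K (`mul_pIn_primes_le`). Finally K is arbitrary. -/

/-- The multisets of primes with sum at most `n`. -/
def primeMultisets (n : ℕ) : Set (Multiset ℕ) :=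
  {s | (∀ a ∈ s, a.Prime) ∧ s.sum ≤ n}

/-! ### From prime multisets to multinomial values. -/

/-- A multiset of primes is determined by the product of the factorials of its members. -/
theorem eq_of_prod_factorial_eq (s t : Multiset ℕ) (hs : ∀ a ∈ s, a.Prime)
    (ht : ∀ a ∈ t, a.Prime)
    (h : (s.map Nat.factorial).prod = (t.map Nat.factorial).prod) : s = t := by
  have dvd_max : ∀ u v : Multiset ℕ, (∀ a ∈ u, a.Prime) →
      (u.map Nat.factorial).prod = (v.map Nat.factorial).prod →
      ∀ a ∈ u, ∃ b ∈ v, a ≤ b := by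
    intro u v hu huv a ha
    have h1 : a ∣ (v.map Nat.factorial).prod := by
      rw [← huv]
      exact (Nat.dvd_factorial (hu a ha).pos le_rfl).trans
        (Multiset.dvd_prod (Multiset.mem_map_of_mem _ ha))
    obtain ⟨c, hc, hac⟩ := (Nat.Prime.prime (hu a ha)).exists_mem_multiset_dvd h1
    obtain ⟨b, hb, rfl⟩ := Multiset.mem_map.1 hc
    exact ⟨b, hb, ((hu a ha).dvd_factorial).1 hac⟩
  induction hk : s.card generalizing s t with
  | zero =>
    obtain rfl := Multiset.card_eq_zero.1 hk
    refine (Multiset.eq_zero_of_forall_notMem fun b hb => ?_).symm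
    obtain ⟨c, hc, -⟩ := dvd_max t 0 ht h.symm b hb
    simp at hc
  | succ k ih =>
    have hs0 : s.toFinset.Nonempty := by
      rw [Multiset.toFinset_nonempty]
      rintro rfl
      simp at hk
    obtain ⟨p, hp, hmax⟩ := s.toFinset.exists_max_image id hs0
    rw [Multiset.mem_toFinset] at hp
    -- The largest p in s is at most some b in t, which is at most some c in s, hence at most p; so
    -- p = b.
    have hpt : p ∈ t := by
      obtain ⟨b, hb, hpb⟩ := dvd_max s t hs h p hp
      obtain ⟨c, hc, hbc⟩ := dvd_max t s ht h.symm b hb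
      have := hmax c (Multiset.mem_toFinset.2 hc)
      simp only [id] at this
      obtain rfl : p = b := by omega
      exact hb
    obtain ⟨s', rfl⟩ := Multiset.exists_cons_of_mem hp
    obtain ⟨t', rfl⟩ := Multiset.exists_cons_of_mem hpt
    rw [ih s' t' (fun a ha => hs a (Multiset.mem_cons_of_mem ha))
      (fun a ha => ht a (Multiset.mem_cons_of_mem ha)) ?_ (by simpa using hk)]
    simpa [Nat.factorial_ne_zero] using h

theorem exists_valuesIn_of_multiset {S : Set ℕ} (s : Multiset ℕ) (hs : ∀ a ∈ s, a ∈ S) :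
    ∃ m ∈ valuesIn S s.sum, (s.map Nat.factorial).prod * m = s.sum.factorial := by
  induction s using Quotient.inductionOn with
  | h l =>
    have hsum : ∑ j : Fin l.length, l[j] = l.sum := by
      simp
    have hprod : ∏ j : Fin l.length, (l[j]).factorial = (l.map Nat.factorial).prod := by
      simp
    refine ⟨_, ⟨l.length, fun j => l[j], fun j => hs _ ?_, ?_, rfl⟩, ?_⟩
    · simp
    · simp
    · have := Nat.multinomial_spec univ fun j : Fin l.length => l[j]
      rw [hsum, hprod] at this
      simpa using this

/-- Since 1! = 1, padding with ones up to sum n leaves the product of factorials unchanged. -/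
theorem ncard_primeMultisets_le_MIn (n : ℕ) :
    (primeMultisets n).ncard ≤ MIn ({1} ∪ primes) n := by
  have key : ∀ s ∈ primeMultisets n, ∃ m ∈ valuesIn ({1} ∪ primes) n,
      (s.map Nat.factorial).prod * m = n.factorial := by
    rintro s ⟨hs, hsn⟩
    have := exists_valuesIn_of_multiset (S := {1} ∪ primes)
      (s + Multiset.replicate (n - s.sum) 1) (by
        intro a ha
        rcases Multiset.mem_add.1 ha with ha | ha
        · exact Or.inr (hs a ha)
        · exact Or.inl (Multiset.eq_of_mem_replicate ha))
    simpa [Nat.add_sub_cancel' hsn] using this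
  choose! f hf hfm using key
  refine Set.ncard_le_ncard_of_injOn f hf ?_ (valuesIn_finite _ n)
  intro s hs t ht hst
  refine eq_of_prod_factorial_eq s t hs.1 ht.1 ?_
  have h1 := hfm s hs
  have h2 := hfm t ht
  rw [hst] at h1
  refine Nat.eq_of_mul_eq_mul_right (Nat.pos_of_ne_zero fun h0 => ?_) (h1.trans h2.symm)
  rw [h0, mul_zero] at h2
  exact Nat.factorial_ne_zero n h2.symm

/-- Positive entries with sum n number at most n; padding with zeros is harmless as 0! = 1. -/
theorem valuesIn_subset_values {S : Set ℕ} (hS : ∀ a ∈ S, 0 < a) (n : ℕ) :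
    valuesIn S n ⊆ values n n := by
  rintro m ⟨k, i, hi, hn, rfl⟩
  have hk : k ≤ n := by
    rw [← hn]
    simpa using Finset.sum_le_sum fun (j : Fin k) (_ : j ∈ univ) => Nat.succ_le_of_lt (hS _ (hi j))
  have hinj := Fin.castLE_injective hk
  have h0 : ∀ j, j ∉ Set.range (Fin.castLE hk) → Function.extend (Fin.castLE hk) i 0 j = 0 :=
    fun j hj => Function.extend_apply' i (0 : Fin n → ℕ) j hj
  have h1 : ∀ j, i j = Function.extend (Fin.castLE hk) i 0 (Fin.castLE hk j) :=
    fun j => (hinj.extend_apply i (0 : Fin n → ℕ) j).symm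
  have hsum := Fintype.sum_of_injective _ hinj i _ h0 h1
  refine ⟨Function.extend (Fin.castLE hk) i 0, hsum ▸ hn, ?_⟩
  rw [Nat.multinomial, Nat.multinomial, ← hsum,
    Fintype.prod_of_injective _ hinj (fun j => (i j).factorial)
      (fun j => (Function.extend (Fin.castLE hk) i 0 j).factorial)
      (fun j hj => by rw [h0 j hj, Nat.factorial_zero]) (fun j => by rw [← h1])]

theorem MIn_le_M (n : ℕ) : MIn ({1} ∪ primes) n ≤ M n := by
  refine Set.ncard_le_ncard (valuesIn_subset_values ?_ n) (values_finite n n)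
  rintro a (rfl | ha)
  · exact one_pos
  · exact Nat.Prime.pos ha

/-! ### Counting prime multisets. -/

/-- The multisets of positive integers with sum at most `n` and at most `K` different members are
among the values of this finite set. -/
def fewParts (n : ℕ) : ℕ → Finset (Multiset ℕ)
  | 0 => {0}
  | K + 1 => (fewParts n K ×ˢ (range (n + 1) ×ˢ range (n + 1))).image
      fun x => x.1 + Multiset.replicate x.2.1 x.2.2

theorem card_fewParts_le (n K : ℕ) : (fewParts n K).card ≤ (n + 1) ^ (2 * K) := by
  induction K with
  | zero => simp [fewParts]
  | succ K ih =>
    refine card_image_le.trans ?_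
    rw [card_product, card_product, card_range]
    calc _ ≤ (n + 1) ^ (2 * K) * ((n + 1) * (n + 1)) := Nat.mul_le_mul_right _ ih
      _ = _ := by ring

theorem mem_fewParts {n : ℕ} (K : ℕ) (s : Multiset ℕ) (hpos : ∀ a ∈ s, 0 < a)
    (hsum : s.sum ≤ n) (hK : s.toFinset.card ≤ K) : s ∈ fewParts n K := by
  induction K generalizing s with
  | zero => simpa [fewParts] using hK
  | succ K ih =>
    simp only [fewParts, mem_image, mem_product, mem_range, Prod.exists]
    rcases Multiset.empty_or_exists_mem s with rfl | ⟨a, ha⟩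
    · exact ⟨0, 0, 0, ⟨ih 0 (by simp) (by simp) (by simp), by simp⟩, by simp⟩
    -- Splitting off all copies of one member costs one distinct member; its value and its
    -- multiplicity are both at most n.
    · have hdec : s.filter (· ≠ a) + Multiset.replicate (s.count a) a = s := by
        rw [← Multiset.filter_eq', add_comm]
        exact Multiset.filter_add_not (· = a) s
      have hs := congrArg Multiset.sum hdec
      rw [Multiset.sum_add, Multiset.sum_replicate, smul_eq_mul] at hs
      have hc : s.count a ≤ s.count a * a := Nat.le_mul_of_pos_right _ (hpos a ha)
      refine ⟨s.filter (· ≠ a), s.count a, a, ⟨ih _ ?_ (by omega) ?_, by omega, ?_⟩, hdec⟩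
      · exact fun b hb => hpos b (Multiset.mem_of_mem_filter hb)
      · have : (s.filter (· ≠ a)).toFinset = s.toFinset.erase a := by
          ext b
          simp [and_comm]
        rw [this, card_erase_of_mem (Multiset.mem_toFinset.2 ha)]
        omega
      · have := Multiset.le_sum_of_mem ha
        omega

theorem primeMultisets_finite (n : ℕ) : (primeMultisets n).Finite := by
  refine (fewParts n n).finite_toSet.subset ?_
  rintro s ⟨hs, hsn⟩
  refine mem_fewParts n s (fun a ha => (hs a ha).pos) hsn ?_
  refine (Multiset.toFinset_card_le s).trans (le_trans ?_ hsn)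
  simpa using Multiset.card_nsmul_le_sum (s := s) (a := 1) fun a ha => (hs a ha).one_le

/-- There are at least a constant times `n ^ R` multisets of primes with sum at most `n`. -/
theorem exists_pow_le_ncard_primeMultisets (R : ℕ) :
    ∃ C : ℕ, ∀ n, (n + 1) ^ R ≤ C * (primeMultisets n).ncard := by
  set q : Fin R → ℕ := fun j => Nat.nth Nat.Prime j with hq
  have hqp : ∀ j, (q j).Prime := fun j => Nat.prime_nth_prime j
  have hqi : Function.Injective q := fun i j h =>
    Fin.ext (Nat.nth_injective Nat.infinite_setOfPred_prime h)
  -- With each multiplicity at most n / P the total stays within n; the added 1 keeps P positive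
  -- when R = 0.
  set P := ∑ j, q j + 1 with hP
  refine ⟨P ^ R, fun n => ?_⟩
  set N := n / P with hN
  let f : (Fin R → Fin (N + 1)) → Multiset ℕ := fun c => ∑ j, Multiset.replicate (c j) (q j)
  have hmem : ∀ c, f c ∈ primeMultisets n := by
    intro c
    constructor
    · intro a ha
      obtain ⟨j, -, hj⟩ := Multiset.mem_sum.1 ha
      rw [Multiset.eq_of_mem_replicate hj]
      exact hqp j
    · have h1 : (f c).sum = ∑ j, (c j : ℕ) * q j := by
        simp [f, Multiset.sum_sum]
      rw [h1]
      calc ∑ j, (c j : ℕ) * q j ≤ ∑ j, N * q j :=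
            sum_le_sum fun j _ => Nat.mul_le_mul_right _ (Nat.lt_succ_iff.1 (c j).2)
        _ = N * ∑ j, q j := (mul_sum _ _ _).symm
        _ ≤ N * P := Nat.mul_le_mul_left _ (Nat.le_succ _)
        _ ≤ n := Nat.div_mul_le_self n P
  have hinj : Function.Injective f := by
    intro c d h
    have hcount : ∀ (c : Fin R → Fin (N + 1)) j, (f c).count (q j) = c j := by
      intro c j
      simp [f, Multiset.count_sum', Multiset.count_replicate, hqi.eq_iff]
    funext j
    exact Fin.ext (by rw [← hcount c j, ← hcount d j, h])
  have hcard : (N + 1) ^ R ≤ (primeMultisets n).ncard := by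
    have := Set.ncard_le_ncard (s := Set.range f) (Set.range_subset_iff.2 hmem)
      (primeMultisets_finite n)
    rw [← Set.image_univ, Set.ncard_image_of_injective _ hinj, Set.ncard_univ] at this
    simpa using this
  calc (n + 1) ^ R ≤ (P * (N + 1)) ^ R := by
        refine Nat.pow_le_pow_left ?_ R
        exact Nat.lt_mul_div_succ n (Nat.succ_pos _)
    _ = P ^ R * (N + 1) ^ R := mul_pow _ _ _
    _ ≤ _ := Nat.mul_le_mul_left _ hcard

/-- Removing one part from the prime partitions of `n` having more than `K` different parts. -/
theorem mul_pIn_primes_le (K n : ℕ) :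
    K * pIn primes n ≤ K * (n + 1) ^ (2 * K) + (primeMultisets n).ncard := by
  classical
  set A := (primeMultisets_finite n).toFinset with hA
  have hmemA : ∀ s, s ∈ A ↔ (∀ a ∈ s, a.Prime) ∧ s.sum ≤ n := fun s => by
    simp [hA, primeMultisets]
  set B := A.filter fun s => s.sum = n with hB
  have hp : pIn primes n ≤ B.card := by
    rw [pIn, ← Set.ncard_coe_finset]
    refine Set.ncard_le_ncard_of_injOn (fun l => l.parts) ?_ ?_ B.finite_toSet
    · intro l hl
      simp only [hB, coe_filter, Set.mem_ofPred_eq, hmemA]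
      exact ⟨⟨hl, l.parts_sum.le⟩, l.parts_sum⟩
    · exact fun l _ l' _ h => Nat.Partition.ext h
  set D := B.filter fun s => ¬ s.toFinset.card ≤ K with hD
  have hsplit : B.card ≤ (n + 1) ^ (2 * K) + D.card := by
    rw [← card_filter_add_card_filter_not (s := B) fun s => s.toFinset.card ≤ K]
    refine Nat.add_le_add_right (le_trans (card_le_card ?_) (card_fewParts_le n K)) _
    intro s hs
    simp only [hB, mem_filter, hmemA] at hs
    exact mem_fewParts K s (fun a ha => (hs.1.1.1 a ha).pos) hs.1.1.2 hs.2
  have hdouble : K * D.card ≤ A.card := by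
    calc K * D.card = D.card * K := mul_comm _ _
      _ ≤ ∑ s ∈ D, s.toFinset.card := by
          rw [← smul_eq_mul]
          refine card_nsmul_le_sum _ _ _ fun s hs => ?_
          exact (not_le.1 (mem_filter.1 hs).2).le
      _ = (D.sigma fun s => s.toFinset).card := (card_sigma _ _).symm
      _ ≤ A.card := by
          -- Injective because every s in D has sum n, so the sum left after erasing reveals the
          -- erased part.
          refine card_le_card_of_injOn (fun x => x.1.erase x.2) ?_ ?_
          · rintro ⟨s, a⟩ hx
            simp only [coe_sigma, Set.mem_sigma_iff, mem_coe, hD, hB, mem_filter, hmemA] at hx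
            rw [mem_coe, hmemA]
            refine ⟨fun b hb => hx.1.1.1.1 b (Multiset.mem_of_mem_erase hb), ?_⟩
            have := Multiset.sum_erase (Multiset.mem_toFinset.1 hx.2)
            have := hx.1.1.1.2
            simp only
            omega
          · rintro ⟨s, a⟩ hx ⟨t, b⟩ hy hxy
            simp only [coe_sigma, Set.mem_sigma_iff, mem_coe, hD, hB, mem_filter, hmemA,
              Multiset.mem_toFinset] at hx hy hxy
            have h1 := Multiset.sum_erase hx.2
            have h2 := Multiset.sum_erase hy.2
            rw [hxy] at h1
            have hab : a = b := by omega
            have hst : s = t := by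
              rw [← Multiset.cons_erase hx.2, ← Multiset.cons_erase hy.2, hxy, hab]
            subst hab hst
            rfl
  have hcard : (primeMultisets n).ncard = A.card := Set.ncard_eq_toFinset_card _ _
  rw [hcard]
  calc K * pIn primes n ≤ K * ((n + 1) ^ (2 * K) + D.card) :=
        Nat.mul_le_mul_left _ (hp.trans hsplit)
    _ = K * (n + 1) ^ (2 * K) + K * D.card := mul_add _ _ _
    _ ≤ _ := Nat.add_le_add_left hdouble _

/-! ### Passage to the limit. -/

theorem tendsto_pIn_primes_div_ncard :
    Filter.Tendsto (fun n : ℕ => (pIn primes n : ℝ) / ((primeMultisets n).ncard : ℝ))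
      Filter.atTop (nhds 0) := by
  have bound : ∀ K : ℕ, ∃ C : ℕ, ∀ n : ℕ, (pIn primes n : ℝ) / ((primeMultisets n).ncard : ℝ) ≤
      C / ((n : ℝ) + 1) + 1 / ((K : ℝ) + 1) := by
    intro K
    -- One power more than the (n+1)^(2(K+1)) partitions with few distinct parts, so their share is
    -- O(1/(n+1)).
    obtain ⟨C, hC⟩ := exists_pow_le_ncard_primeMultisets (2 * (K + 1) + 1)
    refine ⟨C, fun n => ?_⟩
    have hpos : (0 : ℝ) < (primeMultisets n).ncard := by
      exact_mod_cast (Set.ncard_pos (primeMultisets_finite n)).2 ⟨0, by simp [primeMultisets]⟩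
    have h1 : ((K : ℝ) + 1) * pIn primes n ≤
        (K + 1) * ((n : ℝ) + 1) ^ (2 * (K + 1)) + (primeMultisets n).ncard := by
      exact_mod_cast mul_pIn_primes_le (K + 1) n
    have h2 : ((n : ℝ) + 1) ^ (2 * (K + 1)) * (n + 1) ≤ C * (primeMultisets n).ncard := by
      rw [← pow_succ]
      exact_mod_cast hC n
    have hn : (0 : ℝ) < (n : ℝ) + 1 := by positivity
    have hK : (0 : ℝ) < (K : ℝ) + 1 := by positivity
    rw [← le_div_iff₀ hn] at h2
    rw [div_le_iff₀ hpos]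
    have h3 : (pIn primes n : ℝ) ≤
        ((n : ℝ) + 1) ^ (2 * (K + 1)) + (primeMultisets n).ncard / ((K : ℝ) + 1) := by
      rw [← mul_le_mul_iff_right₀ hK, mul_add, mul_div_cancel₀ _ hK.ne']
      exact h1
    calc (pIn primes n : ℝ) ≤ _ := h3
      _ ≤ C * (primeMultisets n).ncard / ((n : ℝ) + 1) +
          (primeMultisets n).ncard / ((K : ℝ) + 1) := by gcongr
      _ = _ := by ring
  rw [Metric.tendsto_atTop]
  intro ε hε
  obtain ⟨K, hK⟩ := exists_nat_one_div_lt (half_pos hε)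
  obtain ⟨C, hC⟩ := bound K
  have hlim : Filter.Tendsto (fun n : ℕ => (C : ℝ) / ((n : ℝ) + 1)) Filter.atTop (nhds 0) := by
    have := (tendsto_one_div_add_atTop_nhds_zero_nat (𝕜 := ℝ)).const_mul (C : ℝ)
    simpa [div_eq_mul_inv] using this
  obtain ⟨N, hN⟩ := Filter.eventually_atTop.1 (hlim.eventually_lt_const (half_pos hε))
  refine ⟨N, fun n hn => ?_⟩
  rw [Real.dist_eq, sub_zero, abs_of_nonneg (by positivity)]
  linarith [hC n, hN n hn]

end MultinomialCount

theorem mainTheorem2 :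
    Filter.Tendsto
      (fun n : ℕ => (MultinomialCount.pIn MultinomialCount.primes n : ℝ) /
        (MultinomialCount.MIn ({1} ∪ MultinomialCount.primes) n : ℝ))
      Filter.atTop (nhds 0) ∧
    Filter.Tendsto
      (fun n : ℕ => (MultinomialCount.pIn MultinomialCount.primes n : ℝ) /
        (MultinomialCount.M n : ℝ))
      Filter.atTop (nhds 0) := by
  have h0 := MultinomialCount.tendsto_pIn_primes_div_ncard
  have hpos : ∀ n, (0 : ℝ) < (MultinomialCount.primeMultisets n).ncard := fun n => by
    exact_mod_cast (Set.ncard_pos (MultinomialCount.primeMultisets_finite n)).2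
      ⟨0, by simp [MultinomialCount.primeMultisets]⟩
  refine ⟨squeeze_zero (fun n => by positivity) (fun n => ?_) h0,
    squeeze_zero (fun n => by positivity) (fun n => ?_) h0⟩
  · exact div_le_div_of_nonneg_left (Nat.cast_nonneg _) (hpos n)
      (Nat.cast_le.2 (MultinomialCount.ncard_primeMultisets_le_MIn n))
  · exact div_le_div_of_nonneg_left (Nat.cast_nonneg _) (hpos n)
      (Nat.cast_le.2 ((MultinomialCount.ncard_primeMultisets_le_MIn n).trans
        (MultinomialCount.MIn_le_M n)))
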